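/- Let $\mathfrak A$ be a (not necessarily unital) $C^*$-algebra and let $H,K$ be Hilbert $\mathfrak A$-modules, i.e. complete inner-product $\mathfrak A$-modules with $\mathfrak A$-valued inner products $\langle\cdot,\cdot\rangle$. Write $\mathcal L(H,K)$ for the set of adjointable operators, that is, of the maps $T:H\to K$ for which there is a map $T^*:K\to H$ with $\langle Tx,y\rangle=\langle x,T^*y\rangle$ for all $x\in H$, $y\in K$, and put $\mathcal L(H)=\mathcal L(H,H)$. An operator $T\in\mathcal L(H)$ is positive, written $T\ge 0$, if $\langle Tx,x\rangle\ge 0$ in $\mathfrak A$ for all $x\in H$. Let $H\oplus K$ carry the inner product $\left\langle\binom{x_1}{y_1},\binom{x_2}{y_2}\right\rangle=\langle x_1,x_2\rangle+\langle y_1,y_2\rangle$. For all $A\in\mathcal L(H)$, $B\in\mathcal L(K)$ and $C\in\mathcal L(H,K)$, let $T\in\mathcal L(H\oplus K)$ be the operator $$T=\begin{pmatrix}A&C^*\\ C&B\end{pmatrix}.$$ Then the following two statements are equivalent: (i) $T\ge 0$; (ii) $A\ge 0$, $B\ge 0$ and $$\|\langle Cu,v\rangle\|^2\le\|\langle Au,u\rangle\|\cdot\|\langle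 Bv,v\rangle\|\quad\text{for all }u\in H,\ v\in K.$$ -/

import Mathlib

open scoped WithCStarModule

section Adjointable

variable {𝔄 H K : Type*} [NonUnitalCStarAlgebra 𝔄] [PartialOrder 𝔄]
  [NormedAddCommGroup H] [Module ℂ H] [SMul 𝔄 H] [CStarModule 𝔄 H]
  [NormedAddCommGroup K] [Module ℂ K] [SMul 𝔄 K] [CStarModule 𝔄 K]

variable (𝔄 H K) in
/-- The set `ℒ(H, K)` of adjointable operators between Hilbert `𝔄`-modules: the maps `T : H → K`
for which there is a map `S : K → H` with `⟨T x, y⟩ = ⟨x, S y⟩` for all `x`, `y`. Such a map is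
automatically linear over `ℂ` and over `𝔄`, and bounded when the modules are complete. -/
structure AdjointableOp where
  /-- The underlying map. -/
  toFun : H → K
  exists_adjoint : ∃ S : K → H, ∀ x y, inner 𝔄 (toFun x) y = inner 𝔄 x (S y)

namespace AdjointableOp

instance : CoeFun (AdjointableOp 𝔄 H K) (fun _ => H → K) := ⟨AdjointableOp.toFun⟩

theorem exists_adjoint_symm (T : AdjointableOp 𝔄 H K) :
    ∃ S : K → H, ∀ y x, inner 𝔄 (S y) x = inner 𝔄 y (T x) := by
  obtain ⟨S, hS⟩ := T.exists_adjoint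
  refine ⟨S, fun y x => ?_⟩
  rw [← CStarModule.star_inner x (S y), ← hS, CStarModule.star_inner]

/-- The adjoint `T* ∈ ℒ(K, H)`; it is the unique map with `⟨T* y, x⟩ = ⟨y, T x⟩`. -/
noncomputable def adjoint (T : AdjointableOp 𝔄 H K) : AdjointableOp 𝔄 K H where
  toFun := T.exists_adjoint_symm.choose
  exists_adjoint := ⟨T, T.exists_adjoint_symm.choose_spec⟩

theorem adjoint_inner_left (T : AdjointableOp 𝔄 H K) (y : K) (x : H) :
    inner 𝔄 (T.adjoint y) x = inner 𝔄 y (T x) :=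
  T.exists_adjoint_symm.choose_spec y x

theorem adjoint_inner_right (T : AdjointableOp 𝔄 H K) (x : H) (y : K) :
    inner 𝔄 x (T.adjoint y) = inner 𝔄 (T x) y := by
  rw [← CStarModule.star_inner (T.adjoint y) x, adjoint_inner_left, CStarModule.star_inner]

/-- Positivity `T ≥ 0` of `T ∈ ℒ(H)`: `⟨T x, x⟩ ≥ 0` in `𝔄` for every `x ∈ H`. -/
def IsPositive (T : AdjointableOp 𝔄 H H) : Prop :=
  ∀ x : H, 0 ≤ inner 𝔄 (T x) x

/-- The block operator with rows `(A, C*)` and `(C, B)`, an element of `ℒ(H ⊕ K)`. Here `H ⊕ K`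
is `C⋆ᵐᵒᵈ(𝔄, H × K)`, whose inner product is `⟨x₁, x₂⟩ + ⟨y₁, y₂⟩`. -/
noncomputable def block [StarOrderedRing 𝔄] (A : AdjointableOp 𝔄 H H) (B : AdjointableOp 𝔄 K K)
    (C : AdjointableOp 𝔄 H K) : AdjointableOp 𝔄 C⋆ᵐᵒᵈ(𝔄, H × K) C⋆ᵐᵒᵈ(𝔄, H × K) where
  toFun z := (WithCStarModule.equiv 𝔄 (H × K)).symm
    (A z.1 + C.adjoint z.2, C z.1 + B z.2)
  exists_adjoint := by
    refine ⟨fun z => (WithCStarModule.equiv 𝔄 (H × K)).symm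
      (A.adjoint z.1 + C.adjoint z.2, C z.1 + B.adjoint z.2), fun x y => ?_⟩
    simp only [WithCStarModule.prod_inner, WithCStarModule.equiv_symm_fst,
      WithCStarModule.equiv_symm_snd, CStarModule.inner_add_left, CStarModule.inner_add_right,
      adjoint_inner_left, adjoint_inner_right]
    abel

end AdjointableOp

end Adjointable

/-! With `a = ⟨Au,u⟩`, `b = ⟨Bv,v⟩`, `c = ⟨Cu,v⟩`, block positivity says `a + b + c + c* ≥ 0` for
all `u`, `v`. Replacing `u`, `v` by `x • u`, `y • v` turns `a`, `b`, `c` into `x a x*`, `y b y*`, `y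
c x*`, so both directions become statements about elements of the algebra. (i) ⇒ (ii),
`norm_sq_le_of_nonneg`: `y = -t c*` gives `2t c*c ≤ a + t² c*bc`; take norms and choose `t`. (ii) ⇒
(i), `nonneg_of_norm_mul_mul_sq_le`: in the unitization, `c = q Z p` with `p = (a+ε)^(1/2)`, `q =
(b+ε)^(1/2)`. The norm inequality for all multiples `x • u`, `y • v` forces `‖Z‖ ≤ 1`; complete the
square and let `ε → 0`. -/

section CStarAlgebraLemmas

/-- A strictly positive element `a + ε` has an invertible self-adjoint square root `p`, and
compressing `a` by `p⁻¹` yields a contraction. -/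
theorem exists_sqrt_add_smul_one {M : Type*} [CStarAlgebra M] [PartialOrder M] [StarOrderedRing M]
    {a : M} (ha : 0 ≤ a) {ε : ℝ} (hε : 0 < ε) :
    ∃ p P : M, star p = p ∧ star P = P ∧ p * P = 1 ∧ P * p = 1 ∧ p * p = a + ε • (1 : M) ∧
      ∀ s : M, ‖s * P * a * star (s * P)‖ ≤ ‖s‖ ^ 2 := by
  have hε1 : IsStrictlyPositive (ε • (1 : M)) := isStrictlyPositive_one.smul hε
  have h0 : IsStrictlyPositive (a + ε • (1 : M)) := hε1.nonneg_add ha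
  have hu : IsUnit (CFC.sqrt (a + ε • (1 : M))) := (CFC.isUnit_sqrt_iff _ h0.nonneg).mpr h0.isUnit
  obtain ⟨w, hw⟩ := hu
  have hp : star (w : M) = w := by
    rw [hw]; exact (CFC.sqrt_nonneg _).isSelfAdjoint
  have hP : star ((w⁻¹ : Mˣ) : M) = (w⁻¹ : Mˣ) := by
    have : star w = w := Units.ext hp
    rw [← Units.coe_star, star_inv, this]
  have hpp : (w : M) * w = a + ε • (1 : M) := by
    rw [hw]; exact CFC.sqrt_mul_sqrt_self _ h0.nonneg
  refine ⟨w, (w⁻¹ : Mˣ), hp, hP, w.mul_inv, w.inv_mul, hpp, fun s => ?_⟩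
  have h1 : s * (w⁻¹ : Mˣ) * a * star (s * (w⁻¹ : Mˣ)) ≤ s * star s := by
    calc s * (w⁻¹ : Mˣ) * a * star (s * (w⁻¹ : Mˣ))
        ≤ s * (w⁻¹ : Mˣ) * (a + ε • (1 : M)) * star (s * (w⁻¹ : Mˣ)) :=
          star_right_conjugate_le_conjugate (le_add_of_nonneg_right hε1.nonneg) _
      _ = s * ((w⁻¹ : Mˣ) * w) * (w * (w⁻¹ : Mˣ)) * star s := by
          rw [← hpp, star_mul, hP]; simp only [mul_assoc]
      _ = s * star s := by simp
  calc _ ≤ ‖s * star s‖ :=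
        CStarAlgebra.norm_le_norm_of_nonneg_of_le (star_right_conjugate_nonneg ha _) h1
    _ = ‖s‖ ^ 2 := by rw [CStarRing.norm_self_mul_star, sq]

/-- Without a unit, `s = t = 1` is unavailable; `s = z*z`, `t = z*` give `‖z‖⁴ ≤ ‖z‖³` instead. -/
theorem norm_le_one_of_norm_mul_mul_le {A : Type*} [NonUnitalCStarAlgebra A] {z : A}
    (h : ∀ s t : A, ‖t * z * star s‖ ≤ ‖s‖ * ‖t‖) : ‖z‖ ≤ 1 := by
  rcases (norm_nonneg z).eq_or_lt with h0 | h0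
  · rw [← h0]; exact zero_le_one
  have h2 : ‖star z * z‖ = ‖z‖ * ‖z‖ := CStarRing.norm_star_mul_self
  have h1 := h (star z * z) (star z)
  rw [CStarRing.norm_self_mul_star, h2, norm_star] at h1
  refine le_of_mul_le_mul_right ?_ (pow_pos h0 3)
  linarith

/-- If `c` satisfies the norm Cauchy–Schwarz inequality relative to `a, b ≥ 0` after compression
by all pairs of elements of the algebra, then `a + b + c + c* ≥ 0`. -/
theorem nonneg_of_norm_mul_mul_sq_le {A : Type*} [NonUnitalCStarAlgebra A] [PartialOrder A]
    [StarOrderedRing A] {a b c : A} (ha : 0 ≤ a) (hb : 0 ≤ b)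
    (h : ∀ x y : A, ‖y * c * star x‖ ^ 2 ≤ ‖x * a * star x‖ * ‖y * b * star y‖) :
    0 ≤ a + b + c + star c := by
  rw [← Unitization.inr_nonneg_iff]
  have key : ∀ ε : ℝ, 0 < ε →
      0 ≤ ((a + b + c + star c : A) : Unitization ℂ A) + (2 * ε) • (1 : Unitization ℂ A) := by
    intro ε hε
    obtain ⟨p, P, hp, hP, hpP, hPp, hpp, hpn⟩ :=
      exists_sqrt_add_smul_one (Unitization.inr_nonneg_iff.mpr ha) hε
    obtain ⟨q, Q, hq, hQ, hqQ, hQq, hqq, hqn⟩ :=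
      exists_sqrt_add_smul_one (Unitization.inr_nonneg_iff.mpr hb) hε
    -- The algebra is an ideal of its unitization, so `Q c P` and the test elements `s P`, `t Q` lie
    -- in it and the hypothesis applies.
    have mul_inr (s : A) (w : Unitization ℂ A) : ∃ x : A, (x : Unitization ℂ A) = s * w :=
      ⟨(s * w : Unitization ℂ A).snd, Unitization.ext (by simp) (by simp)⟩
    have inr_mul (s : A) (w : Unitization ℂ A) : ∃ x : A, (x : Unitization ℂ A) = w * s :=
      ⟨(w * s : Unitization ℂ A).snd, Unitization.ext (by simp) (by simp)⟩
    obtain ⟨z', hz'⟩ := mul_inr c P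
    obtain ⟨z, hz⟩ := inr_mul z' Q
    rw [hz'] at hz
    have hz1 : ‖z‖ ≤ 1 := by
      refine norm_le_one_of_norm_mul_mul_le fun s t => ?_
      obtain ⟨x, hx⟩ := mul_inr s P
      obtain ⟨y, hy⟩ := mul_inr t Q
      have e : t * z * star s = y * c * star x := by
        apply Unitization.inr_injective (R := ℂ)
        simp only [Unitization.inr_mul, Unitization.inr_star, hx, hy, hz, star_mul, hP, mul_assoc]
      have hxn : ‖x * a * star x‖ ≤ ‖s‖ ^ 2 := by
        have := hpn s
        rw [← hx] at this
        simpa only [← Unitization.inr_star, ← Unitization.inr_mul, Unitization.norm_inr] using this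
      have hyn : ‖y * b * star y‖ ≤ ‖t‖ ^ 2 := by
        have := hqn t
        rw [← hy] at this
        simpa only [← Unitization.inr_star, ← Unitization.inr_mul, Unitization.norm_inr] using this
      rw [e]
      refine le_of_sq_le_sq ?_ (by positivity)
      calc _ ≤ _ := h x y
        _ ≤ ‖s‖ ^ 2 * ‖t‖ ^ 2 := by gcongr
        _ = _ := by ring
    set Z : Unitization ℂ A := (z : Unitization ℂ A)
    have hZ : star Z * Z ≤ 1 := by
      have hn : ‖star Z * Z‖ ≤ 1 := by
        rw [CStarRing.norm_star_mul_self, Unitization.norm_inr]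
        exact mul_le_one₀ hz1 (norm_nonneg _) hz1
      exact (CStarAlgebra.norm_le_one_iff_of_nonneg _ (star_mul_self_nonneg Z)).mp hn
    have hc : (c : Unitization ℂ A) = q * Z * p := by
      calc (c : Unitization ℂ A) = (q * Q) * c * (P * p) := by rw [hqQ, hPp, one_mul, mul_one]
        _ = q * Z * p := by rw [hz]; simp only [mul_assoc]
    -- Completing the square; the remainder is nonnegative since `Z` is a contraction.
    have e : ((a + b + c + star c : A) : Unitization ℂ A) + (2 * ε) • (1 : Unitization ℂ A) =
        star (Z * p + q) * (Z * p + q) + star p * (1 - star Z * Z) * p := by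
      have h1 : ((a + b + c + star c : A) : Unitization ℂ A) + (2 * ε) • (1 : Unitization ℂ A) =
          p * p + q * q + q * Z * p + p * star Z * q := by
        rw [hpp, hqq, Unitization.inr_add, Unitization.inr_add, Unitization.inr_add,
          Unitization.inr_star, hc, two_mul, add_smul]
        simp only [star_mul, hp, hq, mul_assoc]
        abel
      rw [h1]
      simp only [star_add, star_mul, hp, hq]
      noncomm_ring
    rw [e]
    exact add_nonneg (star_mul_self_nonneg _)
      (star_left_conjugate_nonneg (sub_nonneg.mpr hZ) p)
  have hlim : Filter.Tendsto (fun ε : ℝ => ((a + b + c + star c : A) : Unitization ℂ A) +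
      (2 * ε) • (1 : Unitization ℂ A)) (nhdsWithin 0 (Set.Ioi 0))
      (nhds ((a + b + c + star c : A) : Unitization ℂ A)) := by
    refine Filter.Tendsto.mono_left ?_ nhdsWithin_le_nhds
    refine Continuous.tendsto' (by fun_prop) _ _ ?_
    simp
  exact CStarAlgebra.isClosed_nonneg.mem_of_tendsto hlim
    (Filter.eventually_of_mem self_mem_nhdsWithin key)

/-- A norm Cauchy–Schwarz inequality for off-diagonal entries. -/
theorem norm_sq_le_of_nonneg {A : Type*} [NonUnitalCStarAlgebra A] [PartialOrder A]
    [StarOrderedRing A] {a b c : A}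
    (h : ∀ y : A, 0 ≤ a + y * b * star y + y * c + star (y * c)) :
    ‖c‖ ^ 2 ≤ ‖a‖ * ‖b‖ := by
  have key : ∀ t : ℝ, 2 * t * ‖c‖ ^ 2 ≤ ‖a‖ + t ^ 2 * ‖b‖ * ‖c‖ ^ 2 := by
    intro t
    rcases le_or_gt t 0 with ht | ht
    · nlinarith [norm_nonneg a, mul_nonneg (mul_nonneg (sq_nonneg t) (norm_nonneg b))
        (sq_nonneg ‖c‖), mul_nonneg (neg_nonneg.mpr ht) (sq_nonneg ‖c‖)]
    have h0 := h ((-t) • star c)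
    have h1 : (2 * t) • (star c * c) ≤ a + t ^ 2 • (star c * b * c) := by
      rw [← sub_nonneg]
      convert h0 using 1
      simp only [star_smul, star_star, star_mul, star_trivial, smul_mul_assoc, mul_smul_comm,
        smul_smul, mul_assoc]
      module
    have h2 := CStarAlgebra.norm_le_norm_of_nonneg_of_le
      (smul_nonneg (by positivity) (star_mul_self_nonneg c)) h1
    rw [norm_smul, CStarRing.norm_star_mul_self, Real.norm_of_nonneg (by positivity), ← sq] at h2
    refine h2.trans ((norm_add_le _ _).trans ?_)
    have h3 : ‖star c * b * c‖ ≤ ‖b‖ * ‖c‖ ^ 2 :=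
      calc ‖star c * b * c‖ ≤ ‖star c‖ * ‖b‖ * ‖c‖ := norm_mul₃_le
        _ = ‖b‖ * ‖c‖ ^ 2 := by rw [norm_star]; ring
    rw [norm_smul, Real.norm_of_nonneg (by positivity), mul_assoc (t ^ 2)]
    exact add_le_add_right (mul_le_mul_of_nonneg_left h3 (sq_nonneg t)) _
  rcases (norm_nonneg b).eq_or_lt with h0 | h0
  · rw [← h0, mul_zero]
    -- If `c ≠ 0`, this `t` would give `2(‖a‖ + 1) ≤ ‖a‖`.
    have := key ((‖a‖ + 1) / ‖c‖ ^ 2)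
    by_contra! hc
    rw [← h0, mul_assoc, div_mul_cancel₀ _ hc.ne'] at this
    linarith [norm_nonneg a]
  -- At `t = 1/‖b‖` the quadratic term is half the linear one.
  · have := key ‖b‖⁻¹
    have e : ‖b‖⁻¹ ^ 2 * ‖b‖ = ‖b‖⁻¹ := by field_simp
    rw [e] at this
    rw [mul_comm ‖a‖, ← inv_mul_le_iff₀ h0]
    linarith

end CStarAlgebraLemmas

namespace AdjointableOp

variable {𝔄 H K : Type*} [NonUnitalCStarAlgebra 𝔄] [PartialOrder 𝔄]
  [NormedAddCommGroup H] [Module ℂ H] [SMul 𝔄 H] [CStarModule 𝔄 H]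
  [NormedAddCommGroup K] [Module ℂ K] [SMul 𝔄 K] [CStarModule 𝔄 K]

theorem inner_apply_smul_smul (T : AdjointableOp 𝔄 H K) (x y : 𝔄) (u : H) (v : K) :
    inner 𝔄 (T (x • u)) (y • v) = y * inner 𝔄 (T u) v * star x := by
  rw [CStarModule.inner_op_smul_right, ← T.adjoint_inner_right, CStarModule.inner_op_smul_left,
    T.adjoint_inner_right, mul_assoc]

theorem inner_apply_zero (T : AdjointableOp 𝔄 H K) (v : K) : inner 𝔄 (T 0) v = 0 := by
  rw [← T.adjoint_inner_right, CStarModule.inner_zero_left]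

theorem inner_block [StarOrderedRing 𝔄] (A : AdjointableOp 𝔄 H H) (B : AdjointableOp 𝔄 K K)
    (C : AdjointableOp 𝔄 H K) (z : C⋆ᵐᵒᵈ(𝔄, H × K)) :
    inner 𝔄 (block A B C z) z = inner 𝔄 (A z.1) z.1 + inner 𝔄 (B z.2) z.2 +
      inner 𝔄 (C z.1) z.2 + star (inner 𝔄 (C z.1) z.2) := by
  simp only [block, WithCStarModule.prod_inner, WithCStarModule.equiv_symm_fst,
    WithCStarModule.equiv_symm_snd, CStarModule.inner_add_left, adjoint_inner_left,
    CStarModule.star_inner]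
  abel

theorem isPositive_block_iff [StarOrderedRing 𝔄] (A : AdjointableOp 𝔄 H H)
    (B : AdjointableOp 𝔄 K K) (C : AdjointableOp 𝔄 H K) :
    (block A B C).IsPositive ↔ ∀ (u : H) (v : K),
      0 ≤ inner 𝔄 (A u) u + inner 𝔄 (B v) v + inner 𝔄 (C u) v + star (inner 𝔄 (C u) v) := by
  refine ⟨fun h u v => ?_, fun h z => ?_⟩
  · have := h ((WithCStarModule.equiv 𝔄 (H × K)).symm (u, v))
    rwa [inner_block] at this
  · rw [inner_block]
    exact h _ _

end AdjointableOp

theorem theorem2p3 {𝔄 H K : Type*}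
    [NonUnitalCStarAlgebra 𝔄] [PartialOrder 𝔄] [StarOrderedRing 𝔄]
    [NormedAddCommGroup H] [Module ℂ H] [SMul 𝔄 H] [CStarModule 𝔄 H] [CompleteSpace H]
    [NormedAddCommGroup K] [Module ℂ K] [SMul 𝔄 K] [CStarModule 𝔄 K] [CompleteSpace K]
    (A : AdjointableOp 𝔄 H H) (B : AdjointableOp 𝔄 K K) (C : AdjointableOp 𝔄 H K) :
    (AdjointableOp.block A B C).IsPositive ↔
      A.IsPositive ∧ B.IsPositive ∧
        ∀ (u : H) (v : K),
          ‖inner 𝔄 (C u) v‖ ^ 2 ≤ ‖inner 𝔄 (A u) u‖ * ‖inner 𝔄 (B v) v‖ := by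
  rw [AdjointableOp.isPositive_block_iff]
  constructor
  · intro h
    have hB : B.IsPositive := fun v => by
      simpa [AdjointableOp.inner_apply_zero] using h 0 v
    refine ⟨fun u => by simpa using h u 0, hB, fun u v => norm_sq_le_of_nonneg fun y => ?_⟩
    have := h u (y • v)
    rwa [AdjointableOp.inner_apply_smul_smul, CStarModule.inner_op_smul_right (x := C u)] at this
  · rintro ⟨hA, hB, h⟩ u v
    refine nonneg_of_norm_mul_mul_sq_le (hA u) (hB v) fun x y => ?_
    simpa only [AdjointableOp.inner_apply_smul_smul] using h (x • u) (y • v)
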